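/- **Corollary ($\mathrm{Singl}(\mathrm{BLP}+\mathrm{AIP})$ does not solve $\mathrm{CSP}(\mathbb D_4^{idemp})$).** *Instances.* An instance of the constraint satisfaction problem is a triple $\mathcal I=\langle X,D,\mathbf C\rangle$, where $X$ is a finite set of variables, $D$ assigns a finite domain $D_x$ to every $x\in X$, and $\mathbf C$ is a finite set of constraints $C=R(x_1,\dots,x_m)$ with $x_1,\dots,x_m\in X$ and $R\subseteq D_{x_1}\times\dots\times D_{x_m}$. A solution is a choice of $f(x)\in D_x$ for all $x\in X$ such that $(f(x_1),\dots,f(x_m))\in R$ for every constraint. For a relational structure $\mathbb A$ with finite domain $A$, the instances of $\mathrm{CSP}(\mathbb A)$ are those in which every domain is $A$ and every constraint relation is a relation of $\mathbb A$. An algorithm with answers "Yes"/"No" solves $\mathrm{CSP}(\mathbb A)$ if on every instance of $\mathrm{CSP}(\mathbb A)$ it answers "Yes" if and only if the instance has a solution. *Algorithms.* The linear system $\mathcal I^L$ has an unknown $C^{\mathbf a}$ for every constraint $C=R(x_1,\dots,x_m)$ and $\mathbf a\in R$, an unknown $x^b$ for every $x\in X$ and $b\in D_x$, and the equations $$\sum_{\mathbf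 a\in R}C^{\mathbf a}=1,\qquad \sum_{\mathbf a\in R,\ \mathbf a(i)=b}C^{\mathbf a}=x_i^{b}\quad(i\in[m],\ b\in D_{x_i})$$ for every constraint $C=R(x_1,\dots,x_m)$. $\mathrm{AIP}$ answers "Yes" on $\mathcal I$ if and only if $\mathcal I^L$ has a solution in $\mathbb Z$. $\mathrm{BLP}+\mathrm{AIP}$ finds a solution of $\mathcal I^L$ in $\mathbb Q\cap[0,1]$ with the maximal number of nonzero values (answering "No" if there is no solution), removes from every constraint $C$ all tuples $\mathbf a$ with $C^{\mathbf a}=0$, and answers as $\mathrm{AIP}$ does on the instance obtained. Reducing the domain of $x$ to $B$ means replacing $D_x$ by $B$ and removing from the constraints containing $x$ all tuples whose value at $x$ is not in $B$. $\mathrm{Singl}(\mathrm{Alg})$ repeats the following until nothing changes any more, and then answers "Yes": for each variable $x$ and each $a\in D_x$, if $\mathrm{Alg}$ answers "No" on the instance obtained from the current one by reducing the domain of $x$ to $\{a\}$, then answer "No" if $D_x\setminus\{a\}=\varnothing$, and otherwise reduce the domain of $x$ to $D_x\setminus\{a\}$ in the current instance. *Template.* Write the elements of $\mathbb Z_2^3$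 as $x=(x^1,x^2,x^3)$, where superscripts denote components. The structure $\mathbb D_4$ of the dihedral group of order $8$ has the domain $\mathbb Z_2^3$ and the relations \begin{align*} L_{3}^{1,2}(x_1,x_2,x_3,x_4)&\colon\ x_1^{1}=x_2^{1},\ x_1^{2}=x_2^{2},\ x_3^{1}=x_4^{1},\ x_3^{2}=x_4^{2},\ x_1^{3}+x_2^{3}=x_3^{3}+x_4^{3};\\ L_{2,3}^{1}(x_1,x_2,x_3,x_4)&\colon\ x_1^{1}=x_2^{1}=x_3^{1}=x_4^{1},\ x_1^{2}+x_2^{2}=x_3^{2}+x_4^{2},\ x_1^{3}+x_2^{3}=x_3^{3}+x_4^{3};\\ L_{1,3}^{2}(x_1,x_2,x_3,x_4)&\colon\ x_1^{2}=x_2^{2}=x_3^{2}=x_4^{2},\ x_1^{1}+x_2^{1}=x_3^{1}+x_4^{1},\ x_1^{3}+x_2^{3}=x_3^{3}+x_4^{3};\\ E_{1-2}(x,y)&\colon\ x^{1}=y^{2};\\ E_{2-3}^{0}(x,y)&\colon\ x^{1}=y^{1}=0,\ x^{2}=y^{3};\\ E_{1-3}^{0}(x,y)&\colon\ x^{2}=y^{2}=0,\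 x^{1}=y^{3};\\ R(x,y)&\colon\ x^{1}=y^{2},\ x^{2}=y^{1},\ x^{3}+y^{3}=x^{1}\cdot y^{1}; \end{align*} and $\{(0,0,0)\}$. Let $\mathbb D_4^{idemp}$ be $\mathbb D_4$ extended with all constant relations $\{a\}$, $a\in\mathbb Z_2^3$. *Claim.* The algorithm $\mathrm{Singl}(\mathrm{BLP}+\mathrm{AIP})$ does not solve $\mathrm{CSP}(\mathbb D_4^{idemp})$. -/

import Mathlib

/-! ## Instances of the constraint satisfaction problem -/

/-- A constraint `R(x₁, …, x_m)` with variables from `X` and a finite relation `R` on `A`. -/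
structure CSPConstraint (X A : Type) where
  /-- the number `m` of positions -/
  arity : ℕ
  /-- the variables `x₁, …, x_m`, repetitions allowed -/
  scope : Fin arity → X
  /-- the constraint relation `R` -/
  rel : Finset (Fin arity → A)

/-- A triple `⟨X, D, C⟩`: every variable `x` has a finite domain `D_x ⊆ A`, and the constraints are
indexed by `K`; each constraint relation is contained in the product of the domains. -/
structure CSPInstance (X K A : Type) where
  dom : X → Finset A
  con : K → CSPConstraint X A
  mem_dom : ∀ k, ∀ t ∈ (con k).rel, ∀ i, t i ∈ dom ((con k).scope i)

namespace CSPInstance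

variable {X K A : Type}

/-- The instance has a solution. -/
def HasSolution (I : CSPInstance X K A) : Prop :=
  ∃ f : X → A, (∀ x, f x ∈ I.dom x) ∧
    ∀ k, (fun i => f ((I.con k).scope i)) ∈ (I.con k).rel

open Classical in
/-- Reduce the domain of the variable `x` to `B` and remove from the constraints containing `x` all
tuples whose value at `x` is outside `B`. -/
noncomputable def reduceDomain (I : CSPInstance X K A) (x : X) (B : Finset A) :
    CSPInstance X K A where
  dom := Function.update I.dom x B
  con k :=
    { arity := (I.con k).arity
      scope := (I.con k).scope
      rel := (I.con k).rel.filter fun t => ∀ i, (I.con k).scope i = x → t i ∈ B }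
  mem_dom := by
    intro k t ht i
    have ht' := Finset.mem_filter.mp ht
    by_cases h : (I.con k).scope i = x
    · simpa [Function.update_apply, h] using ht'.2 i h
    · simpa [Function.update_apply, h] using I.mem_dom k t ht'.1 i

open Classical in
/-- Keep in every constraint only the tuples selected by `p`. -/
noncomputable def filterTuples (I : CSPInstance X K A)
    (p : (k : K) → (Fin (I.con k).arity → A) → Prop) : CSPInstance X K A where
  dom := I.dom
  con k :=
    { arity := (I.con k).arity
      scope := (I.con k).scope
      rel := (I.con k).rel.filter (p k) }
  mem_dom := fun k t ht i => I.mem_dom k t (Finset.mem_filter.mp ht).1 i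

/-! ## The linear system of an instance -/

/-- Values in `F` for the unknowns `C^a` and `x^b` of the linear system of `I`. Only the values
with `a ∈ R` (for `C = R(x₁, …, x_m)`) and `b ∈ D_x` are ever used. -/
structure LinAssignment (I : CSPInstance X K A) (F : Type) where
  tup : (k : K) → (Fin (I.con k).arity → A) → F
  var : X → A → F

open Classical in
/-- The equations of the linear system: `∑_{a ∈ R} C^a = 1` for every constraint
`C = R(x₁, …, x_m)`, and `∑_{a ∈ R, a(i) = b} C^a = x_i^b` for every position `i` and
every `b ∈ D_{x_i}`. -/
def IsLinSolution {I : CSPInstance X K A} {F : Type} [CommRing F]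
    (s : I.LinAssignment F) : Prop :=
  (∀ k, ∑ a ∈ (I.con k).rel, s.tup k a = 1) ∧
  ∀ k, ∀ i, ∀ b ∈ I.dom ((I.con k).scope i),
    ∑ a ∈ (I.con k).rel with a i = b, s.tup k a = s.var ((I.con k).scope i) b

/-- A BLP solution: a solution of the linear system in `ℚ ∩ [0, 1]`. -/
def IsBLPSolution {I : CSPInstance X K A} (s : I.LinAssignment ℚ) : Prop :=
  IsLinSolution s ∧
  (∀ k, ∀ a ∈ (I.con k).rel, s.tup k a ∈ Set.Icc (0 : ℚ) 1) ∧
  ∀ x, ∀ b ∈ I.dom x, s.var x b ∈ Set.Icc (0 : ℚ) 1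

open Classical in
/-- The number of unknowns with a nonzero value. -/
noncomputable def numNonzero [Fintype X] [Fintype K] {I : CSPInstance X K A}
    (s : I.LinAssignment ℚ) : ℕ :=
  ∑ k, ((I.con k).rel.filter fun a => s.tup k a ≠ 0).card +
    ∑ x, ((I.dom x).filter fun b => s.var x b ≠ 0).card

/-- A BLP solution with the maximal number of nonzero values. -/
def IsMaxBLPSolution [Fintype X] [Fintype K] {I : CSPInstance X K A}
    (s : I.LinAssignment ℚ) : Prop :=
  IsBLPSolution s ∧ ∀ s' : I.LinAssignment ℚ, IsBLPSolution s' → numNonzero s' ≤ numNonzero s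

theorem IsMaxBLPSolution.ne_zero [Fintype X] [Fintype K] {I : CSPInstance X K A}
    {s r : I.LinAssignment ℚ} (hs : IsMaxBLPSolution s) (hr : IsBLPSolution r) (k : K)
    (a : Fin (I.con k).arity → A) (ha : a ∈ (I.con k).rel) (h : r.tup k a ≠ 0) :
    s.tup k a ≠ 0 := by
  classical
  intro h0
  obtain ⟨⟨⟨hs1, hs2⟩, hs3, hs4⟩, hmax⟩ := hs
  obtain ⟨⟨hr1, hr2⟩, hr3, hr4⟩ := hr
  let m : I.LinAssignment ℚ :=
    ⟨fun k a => (s.tup k a + r.tup k a) / 2, fun x b => (s.var x b + r.var x b) / 2⟩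
  have hm : IsBLPSolution m := by
    refine ⟨⟨fun k => ?_, fun k i b hb => ?_⟩, fun k a ha => ?_, fun x b hb => ?_⟩
    · simp only [m, ← Finset.sum_div, Finset.sum_add_distrib, hs1, hr1]
      norm_num
    · simp only [m, ← Finset.sum_div, Finset.sum_add_distrib]
      rw [← hs2 k i b hb, ← hr2 k i b hb]
    · have h1 := hs3 k a ha
      have h2 := hr3 k a ha
      simp only [Set.mem_Icc, m] at *
      constructor <;> linarith
    · have h1 := hs4 x b hb
      have h2 := hr4 x b hb
      simp only [Set.mem_Icc, m] at *
      constructor <;> linarith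
  have key : ∀ k, ∀ a ∈ (I.con k).rel, (s.tup k a ≠ 0 ∨ r.tup k a ≠ 0) → m.tup k a ≠ 0 := by
    intro k a ha hne h0
    have h1 := (hs3 k a ha).1
    have h2 := (hr3 k a ha).1
    have h3 : (s.tup k a + r.tup k a) / 2 = 0 := h0
    rcases hne with hne | hne <;> apply hne <;> linarith
  have keyv : ∀ x, ∀ b ∈ I.dom x, s.var x b ≠ 0 → m.var x b ≠ 0 := by
    intro x b hb hne h0
    have h1 := (hs4 x b hb).1
    have h2 := (hr4 x b hb).1
    have h3 : (s.var x b + r.var x b) / 2 = 0 := h0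
    apply hne
    linarith
  refine absurd (hmax m hm) (not_le.mpr ?_)
  unfold numNonzero
  refine add_lt_add_of_lt_of_le (Finset.sum_lt_sum (fun k' _ => Finset.card_le_card ?_)
    ⟨k, Finset.mem_univ k, Finset.card_lt_card ⟨?_, fun hsub => ?_⟩⟩)
    (Finset.sum_le_sum fun x _ => Finset.card_le_card ?_)
  · intro c hc
    rw [Finset.mem_filter] at hc ⊢
    exact ⟨hc.1, key k' c hc.1 (Or.inl hc.2)⟩
  · intro c hc
    rw [Finset.mem_filter] at hc ⊢
    exact ⟨hc.1, key k c hc.1 (Or.inl hc.2)⟩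
  · have := hsub (Finset.mem_filter.mpr ⟨ha, key k a ha (Or.inr h)⟩)
    exact (Finset.mem_filter.mp this).2 h0
  · intro c hc
    rw [Finset.mem_filter] at hc ⊢
    exact ⟨hc.1, keyv x c hc.1 hc.2⟩

/-- Any two BLP solutions with the maximal number of nonzero values have the same zero unknowns
`C^a`, so that removing the tuples `a` with `C^a = 0` gives the same instance. -/
theorem filterTuples_eq_of_isMaxBLPSolution [Fintype X] [Fintype K] {I : CSPInstance X K A}
    {s r : I.LinAssignment ℚ} (hs : IsMaxBLPSolution s) (hr : IsMaxBLPSolution r) :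
    (I.filterTuples fun k a => s.tup k a ≠ 0) = I.filterTuples fun k a => r.tup k a ≠ 0 := by
  classical
  unfold filterTuples
  congr 1
  funext k
  congr 1
  ext a
  simp only [Finset.mem_filter]
  exact and_congr_right fun ha => ⟨hr.ne_zero hs.1 k a ha, hs.ne_zero hr.1 k a ha⟩

/-! ## Algorithms

An algorithm is represented by its set of "Yes"-instances: `alg I` says that the answer on `I` is
"Yes", and `¬ alg I` that it is "No". -/

/-- AIP: solve the linear system over `ℤ`. -/
def aip (I : CSPInstance X K A) : Prop :=
  ∃ s : I.LinAssignment ℤ, IsLinSolution s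

/-- `BLP + alg`: find a BLP solution with the maximal number of nonzero values (answer "No" if there
is none), remove all tuples `a` with `C^a = 0` from every constraint `C`, and answer as `alg`
does. The reduced instance does not depend on the solution found, see
`filterTuples_eq_of_isMaxBLPSolution`. -/
def blpPlus [Fintype X] [Fintype K] (alg : CSPInstance X K A → Prop)
    (I : CSPInstance X K A) : Prop :=
  ∃ s : I.LinAssignment ℚ, IsMaxBLPSolution s ∧ alg (I.filterTuples fun k a => s.tup k a ≠ 0)

/-- The total size of the domains. -/
def size [Fintype X] (I : CSPInstance X K A) : ℕ := ∑ x, (I.dom x).card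

open Classical in
/-- The body of the two `for` loops of the singleton algorithm: if `alg` rejects the instance with
`D_x` reduced to `{a}`, then `D_x` is reduced to `D_x \ {a}`; the value `none` stands for the
answer "No", given when nothing is left. -/
noncomputable def singlBody (alg : CSPInstance X K A → Prop) (x : X) (I : CSPInstance X K A)
    (a : A) : Option (CSPInstance X K A) :=
  if alg (I.reduceDomain x {a}) then some I
  else if I.dom x \ {a} = ∅ then none
  else some (I.reduceDomain x (I.dom x \ {a}))

/-- One pass of the `repeat` loop of the singleton algorithm: for each variable `x` and each
`a ∈ D_x`, in some fixed order, run the loop body. -/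
noncomputable def singlRound [Fintype X] (alg : CSPInstance X K A → Prop)
    (I : CSPInstance X K A) : Option (CSPInstance X K A) :=
  (Finset.univ : Finset X).toList.foldlM
    (fun J x => (J.dom x).toList.foldlM (fun J' a => singlBody alg x J' a) J) I

theorem singlBody_eq_or_lt [Fintype X] (alg : CSPInstance X K A → Prop) (x : X)
    (I J : CSPInstance X K A) (a : A) (h : singlBody alg x I a = some J) :
    J = I ∨ J.size < I.size := by
  classical
  unfold singlBody at h
  split_ifs at h with h1 h2
  · exact Or.inl (Option.some.inj h).symm
  · obtain rfl := Option.some.inj h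
    by_cases ha : a ∈ I.dom x
    · right
      refine Finset.sum_lt_sum (fun y _ => ?_) ⟨x, Finset.mem_univ x, ?_⟩
      · by_cases hy : y = x
        · subst hy
          simpa [reduceDomain] using Finset.card_le_card (Finset.sdiff_subset)
        · simp [reduceDomain, hy]
      · simp only [reduceDomain, Function.update_self]
        refine Finset.card_lt_card ⟨?_, fun hs => ?_⟩
        · intro b hb
          simp only [Finset.mem_sdiff] at hb
          exact hb.1
        · simpa using hs ha
    · left
      have hB : I.dom x \ {a} = I.dom x := by
        ext b
        simp only [Finset.mem_sdiff, Finset.mem_singleton]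
        exact ⟨fun h => h.1, fun h => ⟨h, fun hb => ha (hb ▸ h)⟩⟩
      have hcon : ∀ k, (I.con k).rel.filter
          (fun t => ∀ i, (I.con k).scope i = x → t i ∈ I.dom x \ {a}) = (I.con k).rel := by
        intro k
        refine Finset.filter_true_of_mem fun t ht i hi => ?_
        convert I.mem_dom k t ht i using 1
        rw [hi]
        convert hB
      cases I with
      | mk dom con mem =>
        unfold reduceDomain
        congr 1
        · rw [Function.update_eq_self_iff]
          convert hB
        · funext k
          conv_rhs => rw [show con k = ⟨(con k).arity, (con k).scope, (con k).rel⟩ from rfl]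
          congr 1
          convert hcon k

theorem foldlM_eq_or_lt [Fintype X] {ι : Type}
    (g : CSPInstance X K A → ι → Option (CSPInstance X K A))
    (hg : ∀ I i J, g I i = some J → J = I ∨ J.size < I.size) (l : List ι) :
    ∀ I J, l.foldlM g I = some J → J = I ∨ J.size < I.size := by
  induction l with
  | nil =>
    intro I J h
    simp only [List.foldlM_nil] at h
    exact Or.inl (Option.some.inj h).symm
  | cons i l ih =>
    intro I J h
    simp only [List.foldlM_cons] at h
    obtain ⟨I', h1, h2⟩ := Option.bind_eq_some_iff.mp h
    rcases hg I i I' h1 with rfl | h3 <;> rcases ih _ J h2 with rfl | h4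
    · exact Or.inl rfl
    · exact Or.inr h4
    · exact Or.inr h3
    · exact Or.inr (h4.trans h3)

/-- A pass of the `repeat` loop that changes the instance makes the domains smaller, so that the
loop terminates. -/
theorem singlRound_eq_or_lt [Fintype X] (alg : CSPInstance X K A → Prop)
    (I J : CSPInstance X K A) (h : singlRound alg I = some J) : J = I ∨ J.size < I.size :=
  foldlM_eq_or_lt _
    (fun I' x J' h' => foldlM_eq_or_lt _ (fun I'' a J'' => singlBody_eq_or_lt alg x I'' J'' a)
      _ I' J' h') _ I J h

open Classical in
/-- The singleton algorithm `Singl alg`: repeat the passes until one of them answers "No" or nothing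
changes any more; in the latter case the answer is "Yes". -/
noncomputable def singl [Fintype X] (alg : CSPInstance X K A → Prop)
    (I : CSPInstance X K A) : Prop :=
  match h : singlRound alg I with
  | none => False
  | some J => if hJ : J = I then True else singl alg J
termination_by I.size
decreasing_by exact (singlRound_eq_or_lt alg I J h).resolve_left hJ

end CSPInstance

/-! ## Templates -/

/-- A relational structure with the domain `A`: symbols with arities, and a relation on `A` for
each symbol. -/
structure CSPTemplate (A : Type) where
  Sym : Type
  arity : Sym → ℕ
  rel : (R : Sym) → Finset (Fin (arity R) → A)

namespace CSPTemplate

variable {A : Type}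

/-- The structure extended with all constant relations `{a}`. -/
def withConstants (S : CSPTemplate A) : CSPTemplate A where
  Sym := S.Sym ⊕ A
  arity := Sum.elim S.arity fun _ => 1
  rel
    | Sum.inl R => S.rel R
    | Sum.inr a => {fun _ => a}

/-- `I` is an instance of `CSP(S)`: every domain is the whole domain `A` of `S`, the constraints form
a set (none is listed twice), and every constraint relation is a relation of `S`. -/
def IsInstance [Fintype A] (S : CSPTemplate A) {X K : Type} (I : CSPInstance X K A) : Prop :=
  (∀ x, I.dom x = Finset.univ) ∧ Function.Injective I.con ∧
  ∀ k, ∃ R : S.Sym,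
    (⟨(I.con k).arity, (I.con k).rel⟩ : Σ m : ℕ, Finset (Fin m → A)) = ⟨S.arity R, S.rel R⟩

/-- The algorithm solves `CSP(S)`: on every instance with finitely many variables and constraints the
answer is "Yes" if and only if the instance has a solution. -/
def SolvedBy [Fintype A] (S : CSPTemplate A)
    (alg : ∀ (X K : Type) [Fintype X] [Fintype K], CSPInstance X K A → Prop) : Prop :=
  ∀ (X K : Type) [Fintype X] [Fintype K] (I : CSPInstance X K A),
    S.IsInstance I → (alg X K I ↔ I.HasSolution)

end CSPTemplate

/-- The symbols of the structure of the dihedral group. -/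
inductive DihedralSym : Type
  | L3_12 | L23_1 | L13_2 | E1_2 | E23_0 | E13_0 | R | zero

/-- The structure of the dihedral group of order eight on `(ℤ/2)³`. The components of a vector are
numbered `0, 1, 2` here, and so are the positions of a tuple. -/
def dihedralTemplate : CSPTemplate (Fin 3 → ZMod 2) where
  Sym := DihedralSym
  arity
    | .L3_12 => 4
    | .L23_1 => 4
    | .L13_2 => 4
    | .E1_2 => 2
    | .E23_0 => 2
    | .E13_0 => 2
    | .R => 2
    | .zero => 1
  rel
    | .L3_12 => Finset.univ.filter fun x : Fin 4 → Fin 3 → ZMod 2 =>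
        x 0 0 = x 1 0 ∧ x 0 1 = x 1 1 ∧ x 2 0 = x 3 0 ∧ x 2 1 = x 3 1 ∧
          x 0 2 + x 1 2 = x 2 2 + x 3 2
    | .L23_1 => Finset.univ.filter fun x : Fin 4 → Fin 3 → ZMod 2 =>
        (x 0 0 = x 1 0 ∧ x 1 0 = x 2 0 ∧ x 2 0 = x 3 0) ∧
          x 0 1 + x 1 1 = x 2 1 + x 3 1 ∧ x 0 2 + x 1 2 = x 2 2 + x 3 2
    | .L13_2 => Finset.univ.filter fun x : Fin 4 → Fin 3 → ZMod 2 =>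
        (x 0 1 = x 1 1 ∧ x 1 1 = x 2 1 ∧ x 2 1 = x 3 1) ∧
          x 0 0 + x 1 0 = x 2 0 + x 3 0 ∧ x 0 2 + x 1 2 = x 2 2 + x 3 2
    | .E1_2 => Finset.univ.filter fun x : Fin 2 → Fin 3 → ZMod 2 => x 0 0 = x 1 1
    | .E23_0 => Finset.univ.filter fun x : Fin 2 → Fin 3 → ZMod 2 =>
        (x 0 0 = x 1 0 ∧ x 1 0 = 0) ∧ x 0 1 = x 1 2
    | .E13_0 => Finset.univ.filter fun x : Fin 2 → Fin 3 → ZMod 2 =>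
        (x 0 1 = x 1 1 ∧ x 1 1 = 0) ∧ x 0 0 = x 1 2
    | .R => Finset.univ.filter fun x : Fin 2 → Fin 3 → ZMod 2 =>
        x 0 0 = x 1 1 ∧ x 0 1 = x 1 0 ∧ x 0 2 + x 1 2 = x 0 0 * x 1 0
    | .zero => {fun _ => 0}

/-! The counterexample has two copies of a gadget in which every solution satisfies: if `x` and `xs`
agree in the first two components, then also in the third. The linking constraints make them agree
in the first two components in both copies and make the two third-component differences add up to 1,
so there is no solution (`linkedInstance_not_hasSolution`). BLP and AIP only compare one-variable
marginals of the constraints. A `LocalScheme` provides such marginals for the uniform distribution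
(BLP) and for a signed integer one (AIP). Since the uniform distribution charges every sample, its
support contains that of the signed one, so BLP + AIP accepts. In one copy the scheme cheats. Its
constraints force `x` to have the law of `swapAut g`, where `g` is the random value of `xs`, and
`signedWeight` is chosen so that `flip3 g` has the same law. Hence `x` can be sampled as `flip3 g`,
which differs from `xs` exactly in the third component, as the linking needs. The other copy holds
an honest solution through any prescribed value. Fixing a variable in one copy thus leaves the other
free to cheat, and the singleton algorithm never rejects a value of `linkedDom`
(`singl_blpPlus_aip`). -/

namespace CSPInstance

variable {X K A : Type}

/-! ### Pairs of laws with consistent marginals, and acceptance by BLP + AIP -/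

open Classical in
/-- A random tuple for every constraint and a random value for every variable, all defined on the
same finite space `Ω`, such that the marginals of the tuples have the laws of the values, both for
the uniform distribution and for the signed integer distribution `wt`. -/
structure LocalScheme (I : CSPInstance X K A) (Ω : Type) [Fintype Ω] where
  tup : (k : K) → Ω → Fin (I.con k).arity → A
  var : X → Ω → A
  wt : Ω → ℤ
  sum_wt : ∑ ω, wt ω = 1
  tup_mem : ∀ k ω, tup k ω ∈ (I.con k).rel
  card_eq : ∀ k i b, (Finset.univ.filter fun ω => tup k ω i = b).card =
    (Finset.univ.filter fun ω => var ((I.con k).scope i) ω = b).card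
  wt_eq : ∀ k i b, ∑ ω with tup k ω i = b, wt ω = ∑ ω with var ((I.con k).scope i) ω = b, wt ω

open Classical in
/-- The values of the unknowns given by random tuples and random values with the weights `c`. -/
noncomputable def lawAssignment (I : CSPInstance X K A) {Ω F : Type} [Fintype Ω] [CommRing F]
    (tup : (k : K) → Ω → Fin (I.con k).arity → A) (var : X → Ω → A) (c : Ω → F) :
    I.LinAssignment F where
  tup k t := ∑ ω with tup k ω = t, c ω
  var x b := ∑ ω with var x ω = b, c ω

open Classical in
theorem isLinSolution_lawAssignment {I : CSPInstance X K A} {Ω F : Type} [Fintype Ω] [CommRing F]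
    {tup : (k : K) → Ω → Fin (I.con k).arity → A} {var : X → Ω → A} {c : Ω → F}
    (hc : ∑ ω, c ω = 1) (hmem : ∀ k ω, tup k ω ∈ (I.con k).rel)
    (heq : ∀ k i b, ∑ ω with tup k ω i = b, c ω =
      ∑ ω with var ((I.con k).scope i) ω = b, c ω) :
    IsLinSolution (I.lawAssignment tup var c) := by
  refine ⟨fun k => ?_, fun k i b _ => ?_⟩
  · rw [← hc]
    exact Finset.sum_fiberwise_of_maps_to (fun ω _ => hmem k ω) c
  · simp only [lawAssignment]
    rw [← heq k i b, ← Finset.sum_fiberwise_of_maps_to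
      (s := Finset.univ.filter fun ω => tup k ω i = b) (g := tup k)
      (t := (I.con k).rel.filter fun a => a i = b)
      (fun ω hω => Finset.mem_filter.mpr ⟨hmem k ω, (Finset.mem_filter.mp hω).2⟩) c]
    refine Finset.sum_congr rfl fun a ha => Finset.sum_congr ?_ fun _ _ => rfl
    ext ω
    have := (Finset.mem_filter.mp ha).2
    simp only [Finset.mem_filter, Finset.mem_univ, true_and]
    exact ⟨fun h => ⟨h ▸ this, h⟩, fun h => h.2⟩

theorem mem_rel_filterTuples {I : CSPInstance X K A}
    {p : (k : K) → (Fin (I.con k).arity → A) → Prop} {k : K} {t : Fin (I.con k).arity → A} :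
    t ∈ ((I.filterTuples p).con k).rel ↔ t ∈ (I.con k).rel ∧ p k t :=
  @Finset.mem_filter _ (p k) (fun _ => Classical.propDecidable _) (I.con k).rel t

theorem mem_rel_reduceDomain {I : CSPInstance X K A} {x : X} {B : Finset A} {k : K}
    {t : Fin (I.con k).arity → A} :
    t ∈ ((I.reduceDomain x B).con k).rel ↔
      t ∈ (I.con k).rel ∧ ∀ i, (I.con k).scope i = x → t i ∈ B := by
  unfold reduceDomain
  convert Finset.mem_filter using 1

theorem exists_isMaxBLPSolution [Fintype X] [Fintype K] {I : CSPInstance X K A}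
    {s : I.LinAssignment ℚ} (hs : IsBLPSolution s) :
    ∃ r : I.LinAssignment ℚ, IsMaxBLPSolution r := by
  classical
  let N := {n : ℕ | ∃ r : I.LinAssignment ℚ, IsBLPSolution r ∧ numNonzero r = n}
  have hN : BddAbove N := by
    refine ⟨∑ k, (I.con k).rel.card + ∑ x, (I.dom x).card, ?_⟩
    rintro n ⟨r, -, rfl⟩
    exact add_le_add (Finset.sum_le_sum fun k _ => Finset.card_filter_le _ _)
      (Finset.sum_le_sum fun x _ => Finset.card_filter_le _ _)
  obtain ⟨r, hr, hn⟩ := Nat.sSup_mem (s := N) ⟨_, s, hs, rfl⟩ hN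
  exact ⟨r, hr, fun r' hr' => hn ▸ le_csSup hN ⟨r', hr', rfl⟩⟩

/-- `BLP + AIP` accepts if some integer solution of the linear system is supported in the support of
some BLP solution. -/
theorem blpPlus_aip_of_support [Fintype X] [Fintype K] {I : CSPInstance X K A}
    {s : I.LinAssignment ℚ} (hs : IsBLPSolution s) {z : I.LinAssignment ℤ} (hz : IsLinSolution z)
    (h : ∀ k, ∀ a ∈ (I.con k).rel, z.tup k a ≠ 0 → s.tup k a ≠ 0) : blpPlus aip I := by
  classical
  obtain ⟨r, hr⟩ := exists_isMaxBLPSolution hs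
  refine ⟨r, hr, ⟨z.tup, z.var⟩, fun k => ?_, fun k i b hb => ?_⟩
  · rw [← hz.1 k]
    -- The tuples removed are zeros of every BLP solution, hence of `z`, so no sum changes.
    refine Finset.sum_subset (fun a ha => (mem_rel_filterTuples.mp ha).1) fun a ha hn => ?_
    by_contra h0
    exact hn (mem_rel_filterTuples.mpr ⟨ha, hr.ne_zero hs k a ha (h k a ha h0)⟩)
  · refine Eq.trans ?_ (hz.2 k i b hb)
    refine Finset.sum_subset
      (Finset.filter_subset_filter _ fun a ha => (mem_rel_filterTuples.mp ha).1) fun a ha hn => ?_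
    obtain ⟨ha, hab⟩ := Finset.mem_filter.mp ha
    by_contra h0
    exact hn (Finset.mem_filter.mpr ⟨mem_rel_filterTuples.mpr
      ⟨ha, hr.ne_zero hs k a ha (h k a ha h0)⟩, hab⟩)

/-- The uniform law gives the BLP solution and the law under `wt` the integer one. A tuple of
nonzero signed weight is taken at some sample, so its uniform probability is positive. -/
theorem LocalScheme.blpPlus_aip [Fintype X] [Fintype K] {I : CSPInstance X K A} {Ω : Type}
    [Fintype Ω] (S : LocalScheme I Ω) : blpPlus aip I := by
  classical
  have hne : Nonempty Ω := by
    by_contra hne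
    rw [not_nonempty_iff] at hne
    simpa using S.sum_wt
  have hpos : (0 : ℚ) < Fintype.card Ω := by exact_mod_cast Fintype.card_pos
  let c : Ω → ℚ := fun _ => (Fintype.card Ω : ℚ)⁻¹
  have hc0 : ∀ ω, 0 < c ω := fun _ => inv_pos.mpr hpos
  have hc : ∑ ω, c ω = 1 := by simp [c, hpos.ne']
  have hIcc : ∀ p : Ω → Prop, ∑ ω with p ω, c ω ∈ Set.Icc (0 : ℚ) 1 := fun p =>
    ⟨Finset.sum_nonneg fun ω _ => (hc0 ω).le,
      hc ▸ Finset.sum_le_sum_of_subset_of_nonneg (Finset.filter_subset _ _)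
        fun ω _ _ => (hc0 ω).le⟩
  refine blpPlus_aip_of_support (s := I.lawAssignment S.tup S.var c)
    ⟨isLinSolution_lawAssignment hc S.tup_mem fun k i b => ?_,
      fun k a _ => ?_, fun x b _ => ?_⟩
    (isLinSolution_lawAssignment S.sum_wt S.tup_mem S.wt_eq) fun k a _ hz => ?_
  · simp only [c, Finset.sum_const, S.card_eq k i b]
  · simp only [lawAssignment]
    convert hIcc fun ω => S.tup k ω = a
  · simp only [lawAssignment]
    convert hIcc fun ω => S.var x ω = b
  · obtain ⟨ω, hω, -⟩ := Finset.exists_ne_zero_of_sum_ne_zero hz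
    exact (Finset.sum_pos (fun ω _ => hc0 ω) ⟨ω, hω⟩).ne'

/-- Equal uniform laws have equal supports. This transfers bounds on the values of the variables to
the entries of the tuples. -/
theorem LocalScheme.exists_var_eq {I : CSPInstance X K A} {Ω : Type} [Fintype Ω]
    (S : LocalScheme I Ω) (k : K) (i : Fin (I.con k).arity) (ω : Ω) :
    ∃ ω', S.var ((I.con k).scope i) ω' = S.tup k ω i := by
  classical
  have h : 0 < (Finset.univ.filter fun ω' => S.tup k ω' i = S.tup k ω i).card :=
    Finset.card_pos.mpr ⟨ω, by simp⟩
  have h' := S.card_eq k i (S.tup k ω i)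
  obtain ⟨ω', hω'⟩ := Finset.card_pos.mp (lt_of_lt_of_eq h (by convert h'))
  exact ⟨ω', (Finset.mem_filter.mp hω').2⟩

/-! ### Values that the singleton algorithm cannot remove -/

/-- `J` arises from `I` by shrinking domains and constraint relations, but keeps all values and all
tuples allowed by `D`. -/
def Retains (I : CSPInstance X K A) (D : X → Finset A) (J : CSPInstance X K A) : Prop :=
  ∃ (dom : X → Finset A) (rel : (k : K) → Finset (Fin (I.con k).arity → A))
    (mem : ∀ k, ∀ t ∈ rel k, ∀ i, t i ∈ dom ((I.con k).scope i)),
    J = ⟨dom, fun k => ⟨(I.con k).arity, (I.con k).scope, rel k⟩, mem⟩ ∧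
    (∀ x, D x ⊆ dom x) ∧
    ∀ k, ∀ t ∈ (I.con k).rel, (∀ i, t i ∈ D ((I.con k).scope i)) → t ∈ rel k

theorem Retains.refl {I : CSPInstance X K A} {D : X → Finset A} (h : ∀ x, D x ⊆ I.dom x) :
    Retains I D I :=
  ⟨I.dom, fun k => (I.con k).rel, I.mem_dom, rfl, h, fun _ _ ht _ => ht⟩

theorem Retains.subset_dom {I J : CSPInstance X K A} {D : X → Finset A} (h : Retains I D J)
    (x : X) : D x ⊆ J.dom x := by
  obtain ⟨dom, rel, mem, rfl, hD, -⟩ := h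
  exact hD x

theorem Retains.reduceDomain {I J : CSPInstance X K A} {D : X → Finset A} (h : Retains I D J)
    {x : X} {B : Finset A} (hB : D x ⊆ B) : Retains I D (J.reduceDomain x B) := by
  classical
  obtain ⟨dom, rel, mem, rfl, hD, hrel⟩ := h
  let J : CSPInstance X K A :=
    ⟨dom, fun k => ⟨(I.con k).arity, (I.con k).scope, rel k⟩, mem⟩
  refine ⟨(J.reduceDomain x B).dom, fun k => ((J.reduceDomain x B).con k).rel,
    (J.reduceDomain x B).mem_dom, rfl, fun y => ?_, fun k t ht hi => ?_⟩
  · by_cases hy : y = x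
    · subst hy
      simpa [J, CSPInstance.reduceDomain] using hB
    · simpa [J, CSPInstance.reduceDomain, hy] using hD y
  · exact mem_rel_reduceDomain.mpr ⟨hrel k t ht hi, fun i hx => hB (hx ▸ hi i)⟩

/-- All tuples of the scheme have entries in `D`, so `J` has kept them, and their entries at `x`
equal `a`. The scheme therefore lives on the reduced instance as well. -/
theorem Retains.blpPlus_aip [Fintype X] [Fintype K] {I J : CSPInstance X K A} {D : X → Finset A}
    (h : Retains I D J) {Ω : Type} [Fintype Ω] (S : LocalScheme I Ω)
    (hS : ∀ x ω, S.var x ω ∈ D x) {x : X} {a : A} (ha : ∀ ω, S.var x ω = a) :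
    blpPlus aip (J.reduceDomain x {a}) := by
  classical
  obtain ⟨dom, rel, mem, rfl, hD, hrel⟩ := h
  refine LocalScheme.blpPlus_aip (Ω := Ω)
    ⟨S.tup, S.var, S.wt, S.sum_wt, fun k ω => ?_, S.card_eq, S.wt_eq⟩
  refine mem_rel_reduceDomain.mpr ⟨hrel k _ (S.tup_mem k ω) fun i => ?_, fun i hi => ?_⟩
  · obtain ⟨ω', h'⟩ := S.exists_var_eq k i ω
    exact h' ▸ hS _ ω'
  · obtain ⟨ω', h'⟩ := S.exists_var_eq k i ω
    have hi' : (I.con k).scope i = x := hi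
    rw [hi', ha] at h'
    exact Finset.mem_singleton.mpr h'.symm

/-- A rejected value lies outside `D x`, so deleting it spares `D x`, which is nonempty; hence the
answer "No" is not given. -/
theorem Retains.singlBody {alg : CSPInstance X K A → Prop} {I J : CSPInstance X K A}
    {D : X → Finset A} (hne : ∀ x, (D x).Nonempty)
    (halg : ∀ J', Retains I D J' → ∀ x, ∀ a ∈ D x, alg (J'.reduceDomain x {a}))
    (h : Retains I D J) (x : X) (a : A) :
    ∃ J', CSPInstance.singlBody alg x J a = some J' ∧ Retains I D J' := by
  classical
  unfold CSPInstance.singlBody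
  by_cases h1 : alg (J.reduceDomain x {a})
  · exact ⟨J, if_pos h1, h⟩
  · have hsub : D x ⊆ J.dom x \ {a} := fun b hb => Finset.mem_sdiff.mpr
      ⟨h.subset_dom x hb, fun hba => h1 (Finset.mem_singleton.mp hba ▸ halg J h x b hb)⟩
    have h2 : ¬ J.dom x \ {a} = ∅ := ((hne x).mono hsub).ne_empty
    refine ⟨_, (if_neg h1).trans (if_neg ?_), h.reduceDomain ?_⟩
    · convert h2
    · convert hsub

theorem exists_foldlM_eq_some {β ι : Type} {P : β → Prop} {g : β → ι → Option β}
    (hg : ∀ b i, P b → ∃ b', g b i = some b' ∧ P b') (l : List ι) (b : β) (hb : P b) :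
    ∃ b', l.foldlM g b = some b' ∧ P b' := by
  induction l generalizing b with
  | nil => exact ⟨b, rfl, hb⟩
  | cons i l ih =>
    obtain ⟨b', h1, h2⟩ := hg b i hb
    obtain ⟨b'', h3, h4⟩ := ih b' h2
    exact ⟨b'', by rw [List.foldlM_cons, h1]; exact h3, h4⟩

/-- `Retains I D` is an invariant of the loop, and a pass that changes the instance decreases its
size. -/
theorem Retains.singl [Fintype X] {alg : CSPInstance X K A → Prop} {I : CSPInstance X K A}
    {D : X → Finset A} (hne : ∀ x, (D x).Nonempty)
    (halg : ∀ J', Retains I D J' → ∀ x, ∀ a ∈ D x, alg (J'.reduceDomain x {a}))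
    (J : CSPInstance X K A) (h : Retains I D J) : CSPInstance.singl alg J := by
  classical
  induction hn : J.size using Nat.strong_induction_on generalizing J with
  | _ n ih =>
    obtain ⟨J', h1, h2⟩ := exists_foldlM_eq_some (P := Retains I D)
      (g := fun J x => (J.dom x).toList.foldlM (fun J' a => CSPInstance.singlBody alg x J' a) J)
      (fun J x hJ => exists_foldlM_eq_some (fun J a hJ => hJ.singlBody hne halg x a) _ J hJ)
      (Finset.univ : Finset X).toList J h
    have h3 : singlRound alg J = some J' := h1
    rw [CSPInstance.singl]
    split
    · rename_i h4
      simp [h3] at h4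
    · rename_i J'' h4
      obtain rfl : J' = J'' := Option.some.inj (h3.symm.trans h4)
      by_cases hJ : J' = J
      · simp [hJ]
      · rw [dif_neg hJ]
        exact ih _ (hn ▸ (singlRound_eq_or_lt alg J J' h3).resolve_left hJ) J' h2 rfl

/-- `Singl(BLP + AIP)` accepts if every value of every variable is the constant value of that
variable in some local scheme. -/
theorem singl_blpPlus_aip [Fintype X] [Fintype K] {I : CSPInstance X K A} {D : X → Finset A}
    (hD : ∀ x, D x ⊆ I.dom x) (hne : ∀ x, (D x).Nonempty) {Ω : Type} [Fintype Ω]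
    (hS : ∀ x, ∀ a ∈ D x, ∃ S : LocalScheme I Ω,
      (∀ y ω, S.var y ω ∈ D y) ∧ ∀ ω, S.var x ω = a) :
    CSPInstance.singl (blpPlus aip) I :=
  Retains.singl hne (fun J hJ x a ha => by
    obtain ⟨S, h1, h2⟩ := hS x a ha
    exact hJ.blpPlus_aip S h1 h2) I (Retains.refl hD)

end CSPInstance

/-! ### The gadget and the linked instance -/

/-- The exchange of the first two components, followed by adding their product to the third. -/
def swapAut (g : Fin 3 → ZMod 2) : Fin 3 → ZMod 2 := ![g 1, g 0, g 2 + g 0 * g 1]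

/-- Adding one to the third component. -/
def flip3 (g : Fin 3 → ZMod 2) : Fin 3 → ZMod 2 := ![g 0, g 1, g 2 + 1]

/-- The variables of one copy of the gadget. -/
inductive GadgetVar : Type
  | m | m' | n | n' | x | xs | y | fx | fy
  deriving DecidableEq

instance : Fintype GadgetVar where
  elems := {.m, .m', .n, .n', .x, .xs, .y, .fx, .fy}
  complete v := by cases v <;> decide

/-- The variables outside the two copies of the gadget. -/
inductive LinkVar : Type
  | w | z0 | z1
  deriving DecidableEq

instance : Fintype LinkVar where
  elems := {.w, .z0, .z1}
  complete v := by cases v <;> decide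

/-- The constraints of one copy of the gadget. -/
inductive GadgetCon : Type
  | row | colM | colN | swapX | swapY
  deriving DecidableEq

instance : Fintype GadgetCon where
  elems := {.row, .colM, .colN, .swapX, .swapY}
  complete v := by cases v <;> decide

/-- The constraints outside the two copies of the gadget. -/
inductive LinkCon : Type
  | link | twist | zero | one
  deriving DecidableEq

instance : Fintype LinkCon where
  elems := {.link, .twist, .zero, .one}
  complete v := by cases v <;> decide

/-- The variables of the instance: two copies of the gadget and the linking variables. -/
abbrev LinkedVar : Type := (Bool × GadgetVar) ⊕ LinkVar

/-- The constraints of the instance: two copies of the gadget and the linking constraints. -/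
abbrev LinkedCon : Type := (Bool × GadgetCon) ⊕ LinkCon

/-- The relation symbol of a constraint of the instance. -/
def linkedSym : LinkedCon → dihedralTemplate.withConstants.Sym
  | .inl (_, .row) => .inl .L23_1
  | .inl (_, .colM) => .inl .L13_2
  | .inl (_, .colN) => .inl .L13_2
  | .inl (_, .swapX) => .inl .R
  | .inl (_, .swapY) => .inl .R
  | .inr .link => .inl .L3_12
  | .inr .twist => .inl .L3_12
  | .inr .zero => .inr ![0, 0, 0]
  | .inr .one => .inr ![0, 0, 1]

/-- The variables of a constraint of the instance. -/
def linkedScope : (k : LinkedCon) → Fin (dihedralTemplate.withConstants.arity (linkedSym k)) →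
    LinkedVar
  | .inl (i, .row) => ![.inl (i, .m), .inl (i, .m'), .inl (i, .n), .inl (i, .n')]
  | .inl (i, .colM) => ![.inl (i, .m), .inl (i, .m'), .inl (i, .xs), .inl (i, .y)]
  | .inl (i, .colN) => ![.inl (i, .n), .inl (i, .n'), .inl (i, .fx), .inl (i, .fy)]
  | .inl (i, .swapX) => ![.inl (i, .x), .inl (i, .fx)]
  | .inl (i, .swapY) => ![.inl (i, .y), .inl (i, .fy)]
  | .inr .link => ![.inl (false, .x), .inl (false, .xs), .inl (true, .x), .inr .w]
  | .inr .twist => ![.inr .w, .inl (true, .xs), .inr .z0, .inr .z1]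
  | .inr .zero => ![.inr .z0]
  | .inr .one => ![.inr .z1]

/-- An instance without a solution. In every copy of the gadget a solution takes values with the same
third component at `x` and `xs`, which the linking constraints exclude. -/
def linkedInstance : CSPInstance LinkedVar LinkedCon (Fin 3 → ZMod 2) where
  dom _ := Finset.univ
  con k :=
    { arity := dihedralTemplate.withConstants.arity (linkedSym k)
      scope := linkedScope k
      rel := dihedralTemplate.withConstants.rel (linkedSym k) }
  mem_dom _ _ _ _ := Finset.mem_univ _

theorem linkedInstance_isInstance : dihedralTemplate.withConstants.IsInstance linkedInstance := by
  refine ⟨fun _ => rfl, fun k k' h => ?_, fun k => ⟨linkedSym k, rfl⟩⟩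
  -- Distinct constraints already have distinct scopes; passing to lists makes scopes of different
  -- arities comparable.
  have hl : ∀ k k' : LinkedCon,
      List.ofFn (linkedScope k) = List.ofFn (linkedScope k') → k = k' := by decide
  exact hl k k' (congrArg (fun c => List.ofFn c.scope) h)

section Relations

variable {t : Fin 4 → Fin 3 → ZMod 2} {p : Fin 2 → Fin 3 → ZMod 2} {a : Fin 3 → ZMod 2}

theorem mem_rel_L3_12 : t ∈ dihedralTemplate.withConstants.rel (.inl .L3_12) ↔
    t 0 0 = t 1 0 ∧ t 0 1 = t 1 1 ∧ t 2 0 = t 3 0 ∧ t 2 1 = t 3 1 ∧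
      t 0 2 + t 1 2 = t 2 2 + t 3 2 :=
  Finset.mem_filter.trans (and_iff_right (Finset.mem_univ _))

theorem mem_rel_L23_1 : t ∈ dihedralTemplate.withConstants.rel (.inl .L23_1) ↔
    (t 0 0 = t 1 0 ∧ t 1 0 = t 2 0 ∧ t 2 0 = t 3 0) ∧
      t 0 1 + t 1 1 = t 2 1 + t 3 1 ∧ t 0 2 + t 1 2 = t 2 2 + t 3 2 :=
  Finset.mem_filter.trans (and_iff_right (Finset.mem_univ _))

theorem mem_rel_L13_2 : t ∈ dihedralTemplate.withConstants.rel (.inl .L13_2) ↔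
    (t 0 1 = t 1 1 ∧ t 1 1 = t 2 1 ∧ t 2 1 = t 3 1) ∧
      t 0 0 + t 1 0 = t 2 0 + t 3 0 ∧ t 0 2 + t 1 2 = t 2 2 + t 3 2 :=
  Finset.mem_filter.trans (and_iff_right (Finset.mem_univ _))

theorem mem_rel_R : p ∈ dihedralTemplate.withConstants.rel (.inl .R) ↔
    p 0 0 = p 1 1 ∧ p 0 1 = p 1 0 ∧ p 0 2 + p 1 2 = p 0 0 * p 1 0 :=
  Finset.mem_filter.trans (and_iff_right (Finset.mem_univ _))

theorem mem_rel_const {c : Fin 1 → Fin 3 → ZMod 2} :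
    c ∈ dihedralTemplate.withConstants.rel (.inr a) ↔ c = fun _ => a :=
  Finset.mem_singleton

end Relations

/-! ### Unsolvability -/

/-- In every solution the values at `x` and `xs` in a copy of the gadget agree if they agree up to the
third component. -/
theorem gadget_third_eq {f : LinkedVar → Fin 3 → ZMod 2}
    (hf : ∀ k, (fun i => f ((linkedInstance.con k).scope i)) ∈ (linkedInstance.con k).rel) (i : Bool)
    (h0 : f (.inl (i, .x)) 0 = f (.inl (i, .xs)) 0)
    (h1 : f (.inl (i, .x)) 1 = f (.inl (i, .xs)) 1) :
    f (.inl (i, .x)) 2 = f (.inl (i, .xs)) 2 := by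
  obtain ⟨⟨r1, -, -⟩, -, r5⟩ := mem_rel_L23_1.mp (hf (.inl (i, .row)))
  obtain ⟨⟨-, -, c3⟩, c4, c5⟩ := mem_rel_L13_2.mp (hf (.inl (i, .colM)))
  obtain ⟨-, -, d5⟩ := mem_rel_L13_2.mp (hf (.inl (i, .colN)))
  obtain ⟨-, x2, x3⟩ := mem_rel_R.mp (hf (.inl (i, .swapX)))
  obtain ⟨-, y2, y3⟩ := mem_rel_R.mp (hf (.inl (i, .swapY)))
  simp only [linkedInstance, linkedScope, Matrix.cons_val] at r1 r5 c3 c4 c5 d5 x2 x3 y2 y3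
  -- The row gives `m` and `m'` the same first component, so the sum in `colM` vanishes.
  have e1 : f (.inl (i, .xs)) 0 = f (.inl (i, .y)) 0 := by
    rw [r1] at c4
    exact CharTwo.add_eq_zero.mp (c4.symm.trans (CharTwo.add_self_eq_zero _))
  -- The swap changes the third component by the product of the first two, which is the same for `x`
  -- and `y`.
  have e2 : f (.inl (i, .x)) 2 + f (.inl (i, .fx)) 2 =
      f (.inl (i, .y)) 2 + f (.inl (i, .fy)) 2 := by
    rw [x3, y3, ← x2, ← y2, h0, h1, e1, c3]
  have two : (2 : ZMod 2) = 0 := rfl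
  -- The row and the two columns give `xs + y = fx + fy` in the third component; the multiple of
  -- `two` accounts for characteristic 2.
  linear_combination e2 - c5 + r5 + d5 + (f (.inl (i, .fy)) 2 - f (.inl (i, .xs)) 2) * two

/-- The twist makes `w` and `xs` of the second copy differ by 1 in the third component, while the
gadgets force both differences between `x` and `xs` to be 0. -/
theorem linkedInstance_not_hasSolution : ¬ linkedInstance.HasSolution := by
  rintro ⟨f, -, hf⟩
  obtain ⟨l1, l2, l3, l4, l5⟩ := mem_rel_L3_12.mp (hf (.inr .link))
  obtain ⟨t1, t2, -, -, t5⟩ := mem_rel_L3_12.mp (hf (.inr .twist))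
  have h0 := congrFun (congrFun (mem_rel_const.mp (hf (.inr .zero))) 0) 2
  have h1 := congrFun (congrFun (mem_rel_const.mp (hf (.inr .one))) 0) 2
  simp only [linkedInstance, linkedScope, Matrix.cons_val] at l1 l2 l3 l4 l5 t1 t2 t5 h0 h1
  rw [h0, h1, zero_add, ← gadget_third_eq hf true (l3.trans t1) (l4.trans t2), add_comm, ← l5,
    gadget_third_eq hf false l1 l2, CharTwo.add_self_eq_zero] at t5
  exact zero_ne_one t5

/-! ### Local schemes -/

/-- The signed weights of the integer solutions. -/
def signedWeight (g : Fin 3 → ZMod 2) : ℤ :=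
  if g 0 = g 1 then (if g 0 = 0 ∨ g 2 = 0 then 1 else 0) else if g 2 = g 0 then -1 else 0

/-- The sample space of the schemes: pairs of elements of the template. -/
abbrev Sample : Type := (Fin 3 → ZMod 2) × (Fin 3 → ZMod 2)

/-- The weight of a sample. -/
def sampleWeight (ω : Sample) : ℤ := if ω.2 = 0 then signedWeight ω.1 else 0

/-- Two random values have the same law, both for the uniform distribution and for
`sampleWeight`. -/
def SameLaw (u v : Sample → Fin 3 → ZMod 2) : Prop :=
  ∀ b, (Finset.univ.filter fun ω => u ω = b).card = (Finset.univ.filter fun ω => v ω = b).card ∧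
    ∑ ω with u ω = b, sampleWeight ω = ∑ ω with v ω = b, sampleWeight ω

theorem SameLaw.refl (u : Sample → Fin 3 → ZMod 2) : SameLaw u u := fun _ => ⟨rfl, rfl⟩

-- The weights add up to 2 on `g 0 = g 1 = 0`, to 1 on `g 0 = g 1 = 1`, and to -1 on each of the
-- other two classes.
set_option maxRecDepth 100000 in
theorem sum_sampleWeight : ∑ ω, sampleWeight ω = 1 := by decide

-- Both sides are uniform under counting. The signed weight forces `ω.2 = 0`, and the first
-- component of `ω.1` has total weight 1 at 0 and 0 at 1, so both signed laws are the point mass at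
-- 0. The same holds for the second component in `sameLaw_col`.
set_option maxRecDepth 100000 in
theorem sameLaw_row : SameLaw (fun ω => ![ω.1 0, ω.2 1, ω.2 2]) Prod.snd := by
  unfold SameLaw; decide

set_option maxRecDepth 100000 in
theorem sameLaw_col : SameLaw (fun ω => ![ω.2 0, ω.1 1, ω.2 2]) Prod.snd := by
  unfold SameLaw; decide

-- The heart of the cheat. On `g 0 = g 1 = 0` both third components have weight 1, so the flip is
-- invisible; on `g 0 = g 1 = 1` the two maps coincide; the two points of weight -1 are mapped to
-- the same pair, crosswise.
set_option maxRecDepth 100000 in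
theorem sameLaw_swapAut_fst : SameLaw (fun ω => swapAut ω.1) fun ω => flip3 ω.1 := by
  unfold SameLaw; decide

-- `swapAut` is a bijection fixing 0, and the signed law of `ω.2` is the point mass at 0.
set_option maxRecDepth 100000 in
theorem sameLaw_swapAut_snd : SameLaw (fun ω => swapAut ω.2) Prod.snd := by
  unfold SameLaw; decide

/-- The random values in a copy of the gadget that has no solution. -/
def relaxedVar : GadgetVar → Sample → Fin 3 → ZMod 2
  | .m, ω => ω.1
  | .m', ω => ω.2
  | .n, ω => ω.1
  | .n', ω => ω.2
  | .x, ω => flip3 ω.1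
  | .xs, ω => ω.1
  | .y, ω => ω.2
  | .fx, ω => ω.1
  | .fy, ω => ω.2

/-- A family of solutions of the gadget. -/
def gadgetSolution (v : Fin 4 → ZMod 2) : GadgetVar → Fin 3 → ZMod 2
  | .m => ![v 0, v 2, v 3]
  | .m' => ![v 0, v 2, v 3]
  | .n => ![v 0, v 1, v 3]
  | .n' => ![v 0, v 1, v 3]
  | .x => ![v 1, v 2, v 3]
  | .xs => ![v 1, v 2, v 3]
  | .y => ![v 1, v 2, v 3]
  | .fx => swapAut ![v 1, v 2, v 3]
  | .fy => swapAut ![v 1, v 2, v 3]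

theorem exists_gadgetSolution_eq (u : GadgetVar) (a : Fin 3 → ZMod 2) :
    ∃ v, gadgetSolution v u = a := by
  revert a
  cases u <;> decide

/-- The random tuples of the constraints in a copy of the gadget that has no solution. -/
def relaxedTup : (k : GadgetCon) → (i : Bool) → Sample →
    Fin (dihedralTemplate.withConstants.arity (linkedSym (.inl (i, k)))) → Fin 3 → ZMod 2
  | .row, _, ω => ![ω.1, ![ω.1 0, ω.2 1, ω.2 2], ω.1, ![ω.1 0, ω.2 1, ω.2 2]]
  | .colM, _, ω => ![ω.1, ![ω.2 0, ω.1 1, ω.2 2], ω.1, ![ω.2 0, ω.1 1, ω.2 2]]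
  | .colN, _, ω => ![ω.1, ![ω.2 0, ω.1 1, ω.2 2], ω.1, ![ω.2 0, ω.1 1, ω.2 2]]
  | .swapX, _, ω => ![swapAut ω.1, ω.1]
  | .swapY, _, ω => ![swapAut ω.2, ω.2]

/-- The random values of the variables, where the copy `r` of the gadget has no solution. -/
def schemeVar (r : Bool) (v : Fin 4 → ZMod 2) : LinkedVar → Sample → Fin 3 → ZMod 2
  | .inl (i, u), ω => if i = r then relaxedVar u ω else gadgetSolution v u
  | .inr .w, ω => if r then flip3 ω.1 else flip3 (gadgetSolution v .x)
  | .inr .z0, _ => ![0, 0, 0]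
  | .inr .z1, _ => ![0, 0, 1]

/-- The random tuples of the constraints, where the copy `r` of the gadget has no solution. -/
def schemeTup (r : Bool) (v : Fin 4 → ZMod 2) : (k : LinkedCon) → Sample →
    Fin (dihedralTemplate.withConstants.arity (linkedSym k)) → Fin 3 → ZMod 2
  | .inl (i, k), ω =>
    if i = r then relaxedTup k i ω else fun j => schemeVar r v (linkedScope (.inl (i, k)) j) ω
  | .inr k, ω => fun j => schemeVar r v (linkedScope (.inr k) j) ω

theorem schemeVar_relaxed (r : Bool) (v : Fin 4 → ZMod 2) (u : GadgetVar) :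
    schemeVar r v (.inl (r, u)) = relaxedVar u :=
  funext fun _ => if_pos rfl

/-- Tuple entries need not equal the values of the variables: at `m'`, `n'`, `y`, `fy` and `x` only
the laws may agree. -/
theorem relaxedTup_sameLaw (i : Bool) (k : GadgetCon) :
    ∀ j, ∃ u, linkedScope (.inl (i, k)) j = .inl (i, u) ∧
      SameLaw (fun ω => relaxedTup k i ω j) (relaxedVar u) := by
  cases k
  case row =>
    change ∀ j : Fin 4, _
    intro j
    fin_cases j
    exacts [⟨.m, rfl, SameLaw.refl _⟩, ⟨.m', rfl, sameLaw_row⟩, ⟨.n, rfl, SameLaw.refl _⟩,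
      ⟨.n', rfl, sameLaw_row⟩]
  case colM =>
    change ∀ j : Fin 4, _
    intro j
    fin_cases j
    exacts [⟨.m, rfl, SameLaw.refl _⟩, ⟨.m', rfl, sameLaw_col⟩, ⟨.xs, rfl, SameLaw.refl _⟩,
      ⟨.y, rfl, sameLaw_col⟩]
  case colN =>
    change ∀ j : Fin 4, _
    intro j
    fin_cases j
    exacts [⟨.n, rfl, SameLaw.refl _⟩, ⟨.n', rfl, sameLaw_col⟩, ⟨.fx, rfl, SameLaw.refl _⟩,
      ⟨.fy, rfl, sameLaw_col⟩]
  case swapX =>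
    change ∀ j : Fin 2, _
    intro j
    fin_cases j
    exacts [⟨.x, rfl, sameLaw_swapAut_fst⟩, ⟨.fx, rfl, SameLaw.refl _⟩]
  case swapY =>
    change ∀ j : Fin 2, _
    intro j
    fin_cases j
    exacts [⟨.y, rfl, sameLaw_swapAut_snd⟩, ⟨.fy, rfl, SameLaw.refl _⟩]

theorem schemeTup_sameLaw (r : Bool) (v : Fin 4 → ZMod 2) (k : LinkedCon)
    (j : Fin (dihedralTemplate.withConstants.arity (linkedSym k))) :
    SameLaw (fun ω => schemeTup r v k ω j) (schemeVar r v (linkedScope k j)) := by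
  obtain ⟨i, k⟩ | k := k
  · by_cases h : i = r
    · subst h
      obtain ⟨u, hu, hl⟩ := relaxedTup_sameLaw i k j
      rwa [hu, schemeVar_relaxed,
        show (fun ω => schemeTup i v (.inl (i, k)) ω j) = fun ω => relaxedTup k i ω j from
          funext fun ω => congrFun (if_pos rfl) j]
    · rw [show (fun ω => schemeTup r v (.inl (i, k)) ω j) =
        schemeVar r v (linkedScope (.inl (i, k)) j) from funext fun ω => congrFun (if_neg h) j]
      exact SameLaw.refl _
  · exact SameLaw.refl _

theorem add_add_self_zmod_two (a b : ZMod 2) : a + b + a = b := by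
  rw [add_right_comm, CharTwo.add_self_eq_zero, zero_add]

/-- In the honest copy the tuples come from a solution. The linking constraints hold samplewise: the
cheating copy contributes the difference 1, the honest one 0, and `w` carries it through. -/
theorem schemeTup_mem (r : Bool) (v : Fin 4 → ZMod 2) (k : LinkedCon) (ω : Sample) :
    schemeTup r v k ω ∈ dihedralTemplate.withConstants.rel (linkedSym k) := by
  obtain ⟨i, k⟩ | k := k
  · by_cases h : i = r
    · rw [show schemeTup r v (.inl (i, k)) ω = relaxedTup k i ω from if_pos h]
      cases k
      · exact mem_rel_L23_1.mpr (by simp [relaxedTup])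
      · exact mem_rel_L13_2.mpr (by simp [relaxedTup])
      · exact mem_rel_L13_2.mpr (by simp [relaxedTup])
      · exact mem_rel_R.mpr (by simp [relaxedTup, swapAut, add_add_self_zmod_two, mul_comm])
      · exact mem_rel_R.mpr (by simp [relaxedTup, swapAut, add_add_self_zmod_two, mul_comm])
    · rw [show schemeTup r v (.inl (i, k)) ω =
        fun j => schemeVar r v (linkedScope (.inl (i, k)) j) ω from if_neg h]
      cases k
      · exact mem_rel_L23_1.mpr (by
          simp [linkedScope, schemeVar, h, gadgetSolution, CharTwo.add_self_eq_zero])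
      · exact mem_rel_L13_2.mpr (by
          simp [linkedScope, schemeVar, h, gadgetSolution, CharTwo.add_self_eq_zero])
      · exact mem_rel_L13_2.mpr (by
          simp [linkedScope, schemeVar, h, gadgetSolution, swapAut,
            CharTwo.add_self_eq_zero])
      · exact mem_rel_R.mpr (by
          simp [linkedScope, schemeVar, h, gadgetSolution, swapAut, ← add_assoc,
            CharTwo.add_self_eq_zero])
      · exact mem_rel_R.mpr (by
          simp [linkedScope, schemeVar, h, gadgetSolution, swapAut, ← add_assoc,
            CharTwo.add_self_eq_zero])
  · cases k
    · refine mem_rel_L3_12.mpr ?_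
      cases r <;> simp [schemeTup, linkedScope, schemeVar, relaxedVar, gadgetSolution, flip3,
        CharTwo.add_self_eq_zero, add_add_self_zmod_two, ← add_assoc]
    · refine mem_rel_L3_12.mpr ?_
      cases r <;> simp [schemeTup, linkedScope, schemeVar, relaxedVar, gadgetSolution, flip3,
        add_add_self_zmod_two]
    · exact mem_rel_const.mpr (funext fun j : Fin 1 => by fin_cases j; rfl)
    · exact mem_rel_const.mpr (funext fun j : Fin 1 => by fin_cases j; rfl)

/-- The scheme in which the copy `r` of the gadget has no solution and the other copy has the solution
given by `v`. -/
def linkedScheme (r : Bool) (v : Fin 4 → ZMod 2) : linkedInstance.LocalScheme Sample where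
  tup := schemeTup r v
  var := schemeVar r v
  wt := sampleWeight
  sum_wt := sum_sampleWeight
  tup_mem := schemeTup_mem r v
  card_eq k j b := by
    rw [show (linkedInstance.con k).scope j = linkedScope k j from rfl]
    convert (schemeTup_sameLaw r v k j b).1
  wt_eq k j b := by
    rw [show (linkedInstance.con k).scope j = linkedScope k j from rfl]
    convert (schemeTup_sameLaw r v k j b).2

/-! ### Acceptance by the singleton algorithm -/

/-- The values that survive in the singleton algorithm. -/
def linkedDom : LinkedVar → Finset (Fin 3 → ZMod 2)
  | .inr .z0 => {![0, 0, 0]}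
  | .inr .z1 => {![0, 0, 1]}
  | _ => Finset.univ

theorem schemeVar_mem_linkedDom (r : Bool) (v : Fin 4 → ZMod 2) (u : LinkedVar) (ω : Sample) :
    schemeVar r v u ω ∈ linkedDom u := by
  obtain ⟨i, u⟩ | u := u
  · exact Finset.mem_univ _
  · cases u
    · exact Finset.mem_univ _
    · exact Finset.mem_singleton_self _
    · exact Finset.mem_singleton_self _

theorem exists_schemeVar_eq (u : LinkedVar) (a : Fin 3 → ZMod 2) (ha : a ∈ linkedDom u) :
    ∃ r v, ∀ ω, schemeVar r v u ω = a := by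
  obtain ⟨i, u⟩ | u := u
  · obtain ⟨v, rfl⟩ := exists_gadgetSolution_eq u a
    -- The cheating is moved to the copy that does not contain the fixed variable.
    exact ⟨!i, v, fun ω => if_neg (by cases i <;> decide)⟩
  · cases u
    -- When the first copy cheats, `w` is constant, namely the flip of the honest value at `x`.
    · obtain ⟨v, hv⟩ := exists_gadgetSolution_eq .x (flip3 a)
      refine ⟨false, v, fun ω => ?_⟩
      have : flip3 (flip3 a) = a := by clear ha hv; revert a; decide
      rw [← this, ← hv]
      rfl
    · exact ⟨false, 0, fun _ => (Finset.mem_singleton.mp ha).symm⟩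
    · exact ⟨false, 0, fun _ => (Finset.mem_singleton.mp ha).symm⟩

theorem singl_linkedInstance :
    CSPInstance.singl (CSPInstance.blpPlus CSPInstance.aip) linkedInstance :=
  CSPInstance.singl_blpPlus_aip (D := linkedDom) (fun _ => Finset.subset_univ _)
    (fun u => ⟨_, schemeVar_mem_linkedDom false 0 u (0, 0)⟩) fun u a ha => by
      obtain ⟨r, v, h⟩ := exists_schemeVar_eq u a ha
      exact ⟨linkedScheme r v, schemeVar_mem_linkedDom r v, h⟩

theorem mainTheorem5 :
    ¬ dihedralTemplate.withConstants.SolvedBy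
        (fun _ _ _ _ I => CSPInstance.singl (CSPInstance.blpPlus CSPInstance.aip) I) := fun h =>
  linkedInstance_not_hasSolution
    ((h LinkedVar LinkedCon linkedInstance linkedInstance_isInstance).mp singl_linkedInstance)
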